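/- Let $n\ge 3$ be a prime and let $N\ge 2n-1$. Then no deterministic algorithm solves weak $2$-coloring of the $n$-node cycle $C_n$ in the ASYNC LOCAL model with distinct identifiers from $[1,N]$, even if the algorithm is designed for this particular $n$ and $N$. Here a weak $2$-coloring of a graph is a map from its nodes to two colors such that every non-isolated node has at least one neighbor of a different color. In the ASYNC LOCAL model, every node $v$ of a graph $G$ has an identifier $\mathrm{id}(v)\in[1,N]$, distinct identifiers for distinct nodes, an input (here the same for all nodes), a current state, and a register, initially $\bot$, that its neighbors can read. An algorithm consists of a function that gives the initial state of a node from its identifier and its input, and of a function that gives the next state of a node from its current state and the multiset of the contents of its neighbors' registers; states, of unbounded size, are either running or terminated with an output. A scheduling is an arbitrary sequence $S_1,S_2,\dots$ of sets of nodes; at step $i$ all nodes in $S_i$ simultaneously write their current states in their registers, then read the registers of all their neighbors, and then update their states (a terminated node keeps its state forever), while the other nodes do nothing. An algorithm solves weak $2$-coloring of $G$ if, for every assignment of distinct identifiers in $[1,N]$ and for every scheduling, (i) every node that is scheduled infinitely often terminates, whatever the other nodes do, and (ii) whenever all nodes have terminated, their outputs form a weak $2$-coloring of $G$. -/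

import Mathlib

namespace AsyncLocal

/-- The state of a node: either it is still running, with an internal state in `St`, or it has
terminated with an output in `Out`. -/
inductive NodeState (St Out : Type*) where
  | active (s : St) : NodeState St Out
  | term (x : Out) : NodeState St Out

/-- A deterministic algorithm for the ASYNC LOCAL model, with input labels in `Inp`, internal states
in `St` and outputs in `Out`. The initial state depends on the identifier and the input of the node;
the next state of a running node depends on its current state and on the contents of the registers
of its neighbors (`none` is the content `⊥` of a register that has not been written yet). -/
structure Algorithm (Inp St Out : Type*) where
  init : ℕ → Inp → NodeState St Out
  next : St → Multiset (Option (NodeState St Out)) → NodeState St Out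

/-- A global configuration: `reg v` is what the neighbors of `v` read in the register of `v`, and
`cur v` is the current state of `v`, which `v` will write when it is next scheduled. -/
structure Config (V St Out : Type*) where
  reg : V → Option (NodeState St Out)
  cur : V → NodeState St Out

section Model

variable {V Inp St Out : Type*} [Fintype V] [DecidableEq V]

/-- The registers after all nodes of `B` have simultaneously written their current states. -/
def Config.write (c : Config V St Out) (B : Finset V) (v : V) : Option (NodeState St Out) :=
  if v ∈ B then some (c.cur v) else c.reg v

/-- One step of an execution, in which exactly the nodes of `B` are activated: they all write their
states, then read the registers of their neighbors, and then update their states. A terminated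
node keeps its state. -/
def Algorithm.step (A : Algorithm Inp St Out) (G : SimpleGraph V) [DecidableRel G.Adj]
    (c : Config V St Out) (B : Finset V) : Config V St Out where
  reg := c.write B
  cur v :=
    if v ∈ B then
      match c.cur v with
      | .active s => A.next s ((G.neighborFinset v).val.map (c.write B))
      | .term x => .term x
    else c.cur v

/-- The configuration after the first `t` steps of the execution of `A` on `G` with identifiers `ident`,
inputs `inp` and scheduling `S 0, S 1, S 2, …`. -/
def Algorithm.run (A : Algorithm Inp St Out) (G : SimpleGraph V) [DecidableRel G.Adj]
    (ident : V → ℕ) (inp : V → Inp) (S : ℕ → Finset V) : ℕ → Config V St Out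
  | 0 => { reg := fun _ => none, cur := fun v => A.init (ident v) (inp v) }
  | t + 1 => A.step G (A.run G ident inp S t) (S t)

/-- `A` solves on `G`, with inputs `inp`, the problem whose valid outputs are given by `Valid`: for
all assignments of distinct identifiers in `[1, N]` and all schedulings,
* (wait-freeness) every node that is activated infinitely often terminates, whatever the other
  nodes do (a node that is activated finitely often without terminating has crashed);
* (validity) whenever all nodes have terminated, their outputs are valid. -/
def Algorithm.Solves (A : Algorithm Inp St Out) (G : SimpleGraph V) [DecidableRel G.Adj]
    (N : ℕ) (inp : V → Inp) (Valid : (V → Out) → Prop) : Prop :=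
  ∀ ident : V → ℕ, Function.Injective ident → (∀ v, 1 ≤ ident v ∧ ident v ≤ N) →
    ∀ S : ℕ → Finset V,
      (∀ v, (∀ t₀, ∃ t, t₀ ≤ t ∧ v ∈ S t) →
        ∃ t x, (A.run G ident inp S t).cur v = .term x) ∧
      (∀ t x, (∀ v, (A.run G ident inp S t).cur v = .term (x v)) → Valid x)

end Model

/-- A weak 2-coloring: every non-isolated node has a neighbor with a different color. -/
def IsWeakTwoColoring {V : Type*} (G : SimpleGraph V) (color : V → Fin 2) : Prop :=
  ∀ v, (∃ u, G.Adj v u) → ∃ u, G.Adj v u ∧ color u ≠ color v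

end AsyncLocal

/-! Write `n = m + 1`; the identifiers `1, …, 2m + 1` suffice. Give an execution, a sequence of
nonempty blocks `B` of running nodes, the product of the signs `(-1) ^ (#B + 1)`. Activating `i`
alone and then `B` looks to all nodes but `i` like activating `i` together with `B`, and has the
opposite sign. So in a signed sum of a function of the final states on `U`, the activations of nodes
outside `U` cancel (`signedSum_of_subset`). Hence `H U u`, the signed number of executions with
identifiers `u` in which all of `U` output 1, depends only on `u` restricted to `U`, and it is
invariant under rotation of both. Since both colors occur in a weak 2-coloring `x`, the products of
the `x v` and of the `1 - x v` vanish; expanding gives `∑ (-1) ^ #U * H U u = 0` over all `U ≠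
univ`.

Now combine these identities over all injective `u`. Uniform weights would have total divisible by
`n`, which is useless; `exists_weight` instead gives signed integer weights `c` whose marginals are
`0` or `1`. As a proper `U` misses a node, `Q U = ∑ c u * H U u` depends on `c` only through a
marginal, so `Q` is rotation-invariant. As `n` is prime, the sum of `Q` over the `k`-subsets, `0 < k
< n`, is divisible by `n`. Then so is `Q ∅ = ∑ c u = (2m + 1) ⋯ (m + 2)`, a contradiction.

The weights are built coordinate by coordinate (`exists_marginal_eq`). The obstruction is a function
with zero marginals, which `cycles_le_iSup` decomposes when there are enough values. -/

set_option linter.unusedSectionVars false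

/-! ### Integer weightings of injections with prescribed marginals -/

namespace SignedPlacement

open Finset Function

variable {V I : Type*} [DecidableEq V] [DecidableEq I] [Fintype I]

/-- Sum over the value at `i`. -/
def marginal (i : V) : ((V → I) → ℤ) →ₗ[ℤ] ((V → I) → ℤ) where
  toFun f u := ∑ x, f (update u i x)
  map_add' f g := by ext u; simp [sum_add_distrib]
  map_smul' r f := by ext u; simp [mul_sum]

/-- Fix the value at `i` to be `a`. -/
def slice (i : V) (a : I) : ((V → I) → ℤ) →ₗ[ℤ] ((V → I) → ℤ) where
  toFun f u := f (update u i a)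
  map_add' f g := by ext u; simp
  map_smul' r f := by ext u; simp

/-- Restrict to the assignments with value `a` at `i`. -/
def cone (i : V) (a : I) : ((V → I) → ℤ) →ₗ[ℤ] ((V → I) → ℤ) where
  toFun f u := if u i = a then f u else 0
  map_add' f g := by ext u; by_cases h : u i = a <;> simp [h]
  map_smul' r f := by ext u; by_cases h : u i = a <;> simp [h]

lemma marginal_apply (i : V) (f : (V → I) → ℤ) (u : V → I) :
    marginal i f u = ∑ x, f (update u i x) := rfl

lemma slice_apply (i : V) (a : I) (f : (V → I) → ℤ) (u : V → I) :
    slice i a f u = f (update u i a) := rfl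

lemma cone_apply (i : V) (a : I) (f : (V → I) → ℤ) (u : V → I) :
    cone i a f u = if u i = a then f u else 0 := rfl

/-- The functions that depend only on the coordinates in `P` and are supported on the assignments
that are injective on `P` with values in `J`. -/
def placement (P : Finset V) (J : Finset I) : Submodule ℤ ((V → I) → ℤ) where
  carrier := {f | (∀ u u', (∀ i ∈ P, u i = u' i) → f u = f u') ∧
    ∀ u, f u ≠ 0 → Set.InjOn u P ∧ ∀ i ∈ P, u i ∈ J}
  add_mem' {f g} hf hg := by
    refine ⟨fun u u' h => by simp [hf.1 u u' h, hg.1 u u' h], fun u hu => ?_⟩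
    by_cases h : f u = 0
    · exact hg.2 u (by simpa [h] using hu)
    · exact hf.2 u h
  zero_mem' := ⟨fun _ _ _ => rfl, fun u hu => absurd rfl hu⟩
  smul_mem' r f hf := by
    refine ⟨fun u u' h => by simp [hf.1 u u' h], fun u hu => hf.2 u fun h => hu (by simp [h])⟩

/-- The functions in `placement P J` all of whose marginals vanish. -/
def cycles (P : Finset V) (J : Finset I) : Submodule ℤ ((V → I) → ℤ) :=
  placement P J ⊓ ⨅ i ∈ P, LinearMap.ker (marginal i)

lemma mem_cycles {P : Finset V} {J : Finset I} {f : (V → I) → ℤ} :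
    f ∈ cycles P J ↔ f ∈ placement P J ∧ ∀ i ∈ P, marginal i f = 0 := by
  simp [cycles]

lemma placement_mono {P : Finset V} {J J' : Finset I} (h : J ⊆ J') :
    placement P J ≤ placement P J' := fun _ hf =>
  ⟨hf.1, fun u hu => ⟨(hf.2 u hu).1, fun i hi => h ((hf.2 u hu).2 i hi)⟩⟩

lemma cycles_mono {P : Finset V} {J J' : Finset I} (h : J ⊆ J') :
    cycles P J ≤ cycles P J' :=
  inf_le_inf_right _ (placement_mono h)

lemma apply_update_of_mem_placement {P : Finset V} {J : Finset I} {f : (V → I) → ℤ} {i : V}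
    (hf : f ∈ placement P J) (hi : i ∉ P) (u : V → I) (a : I) : f (update u i a) = f u :=
  hf.1 _ _ fun _ hj => update_of_ne (ne_of_mem_of_not_mem hj hi) _ _

lemma slice_mem_placement {P : Finset V} {J : Finset I} {f : (V → I) → ℤ} {i : V} (a : I)
    (hf : f ∈ placement P J) (hi : i ∈ P) : slice i a f ∈ placement (P.erase i) (J.erase a) := by
  refine ⟨fun u u' h => hf.1 _ _ fun j hj => ?_, fun u hu => ?_⟩
  · by_cases hji : j = i
    · subst hji; simp
    · simp [hji, h j (mem_erase.2 ⟨hji, hj⟩)]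
  · obtain ⟨h1, h2⟩ := hf.2 _ hu
    have key : ∀ j ∈ P.erase i, update u i a j = u j := fun j hj =>
      update_of_ne (ne_of_mem_erase hj) _ _
    refine ⟨fun j hj k hk hjk => h1 (mem_of_mem_erase hj) (mem_of_mem_erase hk) ?_,
      fun j hj => mem_erase.2 ⟨fun hja => ?_, ?_⟩⟩
    · rw [key j hj, key k hk, hjk]
    · refine ne_of_mem_erase hj (h1 (mem_of_mem_erase hj) hi ?_)
      rw [key j hj, update_self, hja]
    · rw [← key j hj]; exact h2 j (mem_of_mem_erase hj)

lemma cone_mem_placement {P : Finset V} {J : Finset I} {f : (V → I) → ℤ} {i : V} {a : I}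
    (hf : f ∈ placement (P.erase i) (J.erase a)) (hi : i ∈ P) (ha : a ∈ J) :
    cone i a f ∈ placement P J := by
  refine ⟨fun u u' h => ?_, fun u hu => ?_⟩
  · rw [cone_apply, cone_apply, h i hi, hf.1 u u' fun j hj => h j (mem_of_mem_erase hj)]
  · rw [cone_apply] at hu
    obtain ⟨hia, hu⟩ : u i = a ∧ f u ≠ 0 := by
      by_cases hia : u i = a <;> simp_all
    obtain ⟨h1, h2⟩ := hf.2 _ hu
    refine ⟨fun j hj k hk hjk => ?_, fun j hj => ?_⟩
    · by_cases hji : j = i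
      · by_cases hki : k = i
        · rw [hji, hki]
        · exact absurd (by rw [← hjk, hji, hia]) (ne_of_mem_erase (h2 k (mem_erase.2 ⟨hki, hk⟩)))
      · by_cases hki : k = i
        · exact absurd (by rw [hjk, hki, hia]) (ne_of_mem_erase (h2 j (mem_erase.2 ⟨hji, hj⟩)))
        · exact h1 (mem_erase.2 ⟨hji, hj⟩) (mem_erase.2 ⟨hki, hk⟩) hjk
    · by_cases hji : j = i
      · rwa [hji, hia]
      · exact mem_of_mem_erase (h2 j (mem_erase.2 ⟨hji, hj⟩))

lemma marginal_slice {i j : V} (h : i ≠ j) (a : I) (f : (V → I) → ℤ) :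
    marginal j (slice i a f) = slice i a (marginal j f) := by
  ext u
  simp only [marginal_apply, slice_apply]
  exact sum_congr rfl fun x _ => by rw [update_comm h]

lemma marginal_cone_of_ne {i j : V} (h : i ≠ j) (a : I) (f : (V → I) → ℤ) :
    marginal j (cone i a f) = cone i a (marginal j f) := by
  ext u
  simp only [marginal_apply, cone_apply, update_of_ne h]
  by_cases hu : u i = a <;> simp [hu]

lemma marginal_cone_self {P : Finset V} {J : Finset I} {f : (V → I) → ℤ} {i : V} (a : I)
    (hf : f ∈ placement P J) (hi : i ∉ P) : marginal i (cone i a f) = f := by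
  ext u
  simp [marginal_apply, cone_apply, apply_update_of_mem_placement hf hi]

lemma slice_mem_cycles {P : Finset V} {J : Finset I} {f : (V → I) → ℤ} {i : V} (a : I)
    (hf : f ∈ cycles P J) (hi : i ∈ P) : slice i a f ∈ cycles (P.erase i) (J.erase a) := by
  rw [mem_cycles] at hf ⊢
  refine ⟨slice_mem_placement a hf.1 hi, fun j hj => ?_⟩
  rw [marginal_slice (ne_of_mem_erase hj).symm, hf.2 j (mem_of_mem_erase hj), map_zero]

/-- A suspension: both cones have marginal `f` at `i`, so these cancel, and the other marginals
vanish because those of `f` do. -/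
lemma cone_sub_cone_mem_cycles {P : Finset V} {J : Finset I} {f : (V → I) → ℤ} {i : V} {a b : I}
    (hf : f ∈ cycles (P.erase i) ((J.erase a).erase b)) (hi : i ∈ P) (ha : a ∈ J) (hb : b ∈ J) :
    cone i a f - cone i b f ∈ cycles P J := by
  rw [mem_cycles] at hf ⊢
  refine ⟨Submodule.sub_mem _ (cone_mem_placement (placement_mono ?_ hf.1) hi ha)
    (cone_mem_placement (placement_mono ?_ hf.1) hi hb), fun j hj => ?_⟩
  · exact erase_subset _ _
  · exact erase_subset_erase _ (erase_subset _ _)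
  · rw [map_sub]
    by_cases hji : j = i
    · subst hji
      rw [marginal_cone_self a hf.1 (notMem_erase _ _), marginal_cone_self b hf.1 (notMem_erase _ _),
        sub_self]
    · rw [marginal_cone_of_ne (Ne.symm hji), marginal_cone_of_ne (Ne.symm hji),
        hf.2 j (mem_erase.2 ⟨hji, hj⟩), map_zero, map_zero, sub_self]

/-- Removing all cones with apex value `a` leaves a function that avoids the value `a`. -/
lemma sub_sum_cone_mem_placement {P : Finset V} {J : Finset I} {f : (V → I) → ℤ} (a : I)
    (hf : f ∈ placement P J) :
    f - ∑ i ∈ P, cone i a (slice i a f) ∈ placement P (J.erase a) := by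
  have hval : ∀ u, (f - ∑ i ∈ P, cone i a (slice i a f)) u =
      f u - ∑ i ∈ P, if u i = a then f u else 0 := by
    intro u
    rw [Pi.sub_apply, Finset.sum_apply]
    congr 1
    refine sum_congr rfl fun i _ => ?_
    rw [cone_apply, slice_apply]
    split_ifs with h
    · rw [← h, update_eq_self]
    · rfl
  refine ⟨fun u u' h => ?_, fun u hu => ?_⟩
  · rw [hval, hval, hf.1 u u' h]
    congr 1
    exact sum_congr rfl fun i hi => by rw [h i hi]
  · rw [hval] at hu
    have hfu : f u ≠ 0 := fun h => hu (by simp [h])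
    obtain ⟨h1, h2⟩ := hf.2 u hfu
    refine ⟨h1, fun i hi => mem_erase.2 ⟨fun hia => hu ?_, h2 i hi⟩⟩
    rw [sum_eq_single_of_mem i hi, if_pos hia, sub_self]
    intro j hj hji
    exact if_neg fun hja => hji (h1 hj hi (hja.trans hia.symm))

/-- If there are enough values, every cycle is a sum of cycles that each avoid some value. -/
theorem cycles_le_iSup (P : Finset V) (J : Finset I) (h : 2 * #P + 1 ≤ #J) :
    cycles P J ≤ ⨆ y ∈ J, cycles P (J.erase y) := by
  induction hk : #P generalizing P J with
  | zero =>
    obtain rfl := card_eq_zero.1 hk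
    obtain ⟨y, hy⟩ : J.Nonempty := card_pos.1 (by omega)
    refine le_trans (fun f hf => ?_) (le_iSup₂ (f := fun y _ => cycles ∅ (J.erase y)) y hy)
    rw [mem_cycles] at hf ⊢
    exact ⟨⟨hf.1.1, fun u _ => by simp⟩, by simp⟩
  | succ k ih =>
    set R : Submodule ℤ ((V → I) → ℤ) := ⨆ y ∈ J, cycles P (J.erase y) with hR
    have hsub : ∀ y ∈ J, cycles P (J.erase y) ≤ R := fun y hy =>
      le_iSup₂ (f := fun y _ => cycles P (J.erase y)) y hy
    have hRJ : R ≤ cycles P J := iSup₂_le fun y _ => cycles_mono (erase_subset _ _)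
    obtain ⟨a, ha⟩ : J.Nonempty := card_pos.1 (by omega)
    -- If `w` avoids `a`, `y` and `z`, its cones with apexes `a` and `y` differ by a cycle avoiding
    -- `z`, and the second cone avoids `a`. Finding `y` and `z` uses the induction hypothesis twice,
    -- the second time with both `a` and `y` removed; hence two values per coordinate in `h`.
    have hcone : ∀ i ∈ P, cycles (P.erase i) (J.erase a) ≤
        (R ⊔ placement P (J.erase a)).comap (cone i a) := by
      intro i hi
      have hcard : #(P.erase i) = k := by rw [card_erase_of_mem hi, hk, Nat.add_sub_cancel]
      have hJa : #(J.erase a) = #J - 1 := card_erase_of_mem ha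
      refine (ih _ _ (by omega) hcard).trans (iSup₂_le fun y hy => ?_)
      have hJy : #((J.erase a).erase y) = #J - 2 := by
        rw [card_erase_of_mem hy, hJa]; omega
      refine (ih _ _ (by omega) hcard).trans (iSup₂_le fun z hz w hw => ?_)
      have hw' : w ∈ placement (P.erase i) (((J.erase a).erase y).erase z) := (mem_cycles.1 hw).1
      rw [Submodule.mem_comap, ← sub_add_cancel (cone i a w) (cone i y w)]
      refine Submodule.add_mem_sup (hsub z ?_ (cone_sub_cone_mem_cycles ?_ hi ?_ ?_)) ?_
      · exact mem_of_mem_erase (mem_of_mem_erase hz)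
      · rwa [erase_right_comm (a := z), erase_right_comm (s := J.erase a) (a := z)]
      · exact mem_erase.2 ⟨fun h => by simp [h] at hz, ha⟩
      · exact mem_erase.2 ⟨fun h => by simp [h] at hz, mem_of_mem_erase hy⟩
      · exact cone_mem_placement (placement_mono (erase_subset _ _) hw') hi hy
    intro f hf
    have hfP := (mem_cycles.1 hf).1
    have hmem : f ∈ R ⊔ placement P (J.erase a) := by
      rw [← sub_add_cancel f (∑ i ∈ P, cone i a (slice i a f))]
      refine add_mem (Submodule.mem_sup_right (sub_sum_cone_mem_placement a hfP))
        (Submodule.sum_mem _ fun i hi => ?_)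
      exact hcone i hi (slice_mem_cycles a hf hi)
    obtain ⟨r, hr, g, hg, rfl⟩ := Submodule.mem_sup.1 hmem
    refine add_mem hr (hsub a ha (mem_cycles.2 ⟨hg, ?_⟩))
    have : g ∈ cycles P J := by simpa using sub_mem hf (hRJ hr)
    exact (mem_cycles.1 this).2

lemma marginal_eq_sum_slice {P : Finset V} {J : Finset I} {f : (V → I) → ℤ} {i : V}
    (hf : f ∈ placement P J) (hi : i ∈ P) : marginal i f = ∑ x ∈ J, slice i x f := by
  ext u
  rw [marginal_apply, Finset.sum_apply]
  refine (sum_subset (subset_univ J) fun x _ hx => ?_).symm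
  by_contra hne
  exact hx (by simpa using (hf.2 _ hne).2 i hi)

lemma sum_cone_slice {P : Finset V} {J : Finset I} {f : (V → I) → ℤ} {i : V}
    (hf : f ∈ placement P J) (hi : i ∈ P) : ∑ x ∈ J, cone i x (slice i x f) = f := by
  ext u
  rw [Finset.sum_apply]
  simp only [cone_apply, slice_apply]
  by_cases hu : u i ∈ J
  · rw [sum_eq_single_of_mem (u i) hu fun x _ hx => if_neg (Ne.symm hx)]
    simp
  · rw [sum_eq_zero]
    · by_contra hne
      exact hu ((hf.2 u (Ne.symm hne)).2 i hi)
    · exact fun x hx => if_neg fun (h : u i = x) => hu (h ▸ hx)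

/-- If there are enough values, every consistent family of functions is the family of marginals of
some function. -/
theorem exists_marginal_eq (P : Finset V) (J : Finset I) (h : 2 * #P ≤ #J + 1)
    (b : V → (V → I) → ℤ) (hb : ∀ i ∈ P, b i ∈ placement (P.erase i) J)
    (hbb : ∀ i ∈ P, ∀ j ∈ P, i ≠ j → marginal j (b i) = marginal i (b j)) :
    ∃ c ∈ placement P J, ∀ i ∈ P, marginal i c = b i := by
  induction P using Finset.induction_on generalizing J b with
  | empty => exact ⟨0, zero_mem _, by simp⟩
  | insert p Q hp ih =>
    rw [card_insert_of_notMem hp] at h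
    have hne : ∀ i ∈ Q, i ≠ p := fun i hi => ne_of_mem_of_not_mem hi hp
    have hpi : ∀ i ∈ Q, p ∈ (insert p Q).erase i := fun i hi =>
      mem_erase.2 ⟨(hne i hi).symm, mem_insert_self _ _⟩
    have hbp : b p ∈ placement Q J := by
      simpa [erase_insert hp] using hb p (mem_insert_self _ _)
    -- `c x` is a candidate for the slice at `p` with value `x` of the function sought.
    have hx : ∀ x ∈ J, ∃ c ∈ placement Q (J.erase x), ∀ i ∈ Q, marginal i c = slice p x (b i) := by
      intro x hx
      refine ih (J.erase x) (by rw [card_erase_of_mem hx]; omega) _ (fun i hi => ?_)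
        fun i hi j hj hij => ?_
      · have := slice_mem_placement x (hb i (mem_insert_of_mem hi)) (hpi i hi)
        rwa [erase_right_comm, erase_insert hp] at this
      · rw [marginal_slice (hne j hj).symm, marginal_slice (hne i hi).symm,
          hbb i (mem_insert_of_mem hi) j (mem_insert_of_mem hj) hij]
    choose! c hc hcm using hx
    -- Gluing the `c x` gives the right marginals except at `p`, where this is the error. It is a
    -- cycle, so it splits into cycles `z x` avoiding `x`; adding `z x` to `c x` corrects the error
    -- and leaves the other marginals unchanged.
    have hz : b p - ∑ x ∈ J, c x ∈ cycles Q J := by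
      refine mem_cycles.2 ⟨sub_mem hbp (Submodule.sum_mem _ fun x hx =>
        placement_mono (erase_subset _ _) (hc x hx)), fun i hi => ?_⟩
      rw [map_sub, map_sum, sum_congr rfl fun x hx => hcm x hx i hi,
        ← marginal_eq_sum_slice (hb i (mem_insert_of_mem hi)) (hpi i hi),
        hbb p (mem_insert_self _ _) i (mem_insert_of_mem hi) (hne i hi).symm, sub_self]
    obtain ⟨z, hzs⟩ := (Submodule.mem_iSup_finset_iff_exists_sum _ _).1
      (cycles_le_iSup Q J (by omega) hz)
    have hzm : ∀ x, (z x : (V → I) → ℤ) ∈ placement Q (J.erase x) := fun x =>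
      (mem_cycles.1 (z x).2).1
    refine ⟨∑ x ∈ J, cone p x (c x + z x), Submodule.sum_mem _ fun x hx =>
      cone_mem_placement ?_ (mem_insert_self _ _) hx, fun i hi => ?_⟩
    · rw [erase_insert hp]
      exact add_mem (hc x hx) (hzm x)
    · rw [map_sum]
      rcases mem_insert.1 hi with rfl | hi
      · rw [sum_congr rfl fun x hx => marginal_cone_self x (add_mem (hc x hx) (hzm x)) hp,
          sum_add_distrib, hzs, add_sub_cancel]
      · rw [← sum_cone_slice (hb i (mem_insert_of_mem hi)) (hpi i hi)]
        refine sum_congr rfl fun x hx => ?_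
        rw [marginal_cone_of_ne (hne i hi).symm, map_add, hcm x hx i hi,
          (mem_cycles.1 (z x).2).2 i hi, add_zero]

open Classical in
/-- An integer weighting of the injections `Fin (m + 1) → Fin (2 * m + 1)` all of whose
one-coordinate marginals are the indicator of injectivity on the other coordinates. -/
theorem exists_weight (m : ℕ) : ∃ c : (Fin (m + 1) → Fin (2 * m + 1)) → ℤ,
    (∀ u, c u ≠ 0 → Injective u) ∧
    ∀ i u, ∑ x, c (update u i x) = if Set.InjOn u {i}ᶜ then 1 else 0 := by
  suffices h : ∃ c ∈ placement (univ : Finset (Fin (m + 1))) (univ : Finset (Fin (2 * m + 1))),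
      ∀ i ∈ univ, marginal i c = fun u => if Set.InjOn u {i}ᶜ then 1 else 0 by
    obtain ⟨c, hc, hcm⟩ := h
    exact ⟨c, fun u hu => by simpa [Set.injOn_univ] using (hc.2 u hu).1,
      fun i u => congrFun (hcm i (mem_univ i)) u⟩
  -- The bound is attained: `2 * (m + 1) = (2 * m + 1) + 1`. This is the source of `2n - 1`.
  refine exists_marginal_eq _ _ (by simp; omega) _ ?_ ?_
  · intro i _
    refine ⟨fun u u' h => ?_, fun u hu => ⟨?_, by simp⟩⟩
    · have : Set.EqOn u u' {i}ᶜ := fun j hj => h j (by simpa using hj)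
      simp only [this.injOn_iff]
    · simpa [Set.compl_eq_univ_sdiff] using hu
  · intro i _ j _ hij
    -- The condition on the right is symmetric in `i` and `j`, which makes the family of indicators
    -- consistent.
    have key : ∀ i j : Fin (m + 1), i ≠ j → ∀ (u : Fin (m + 1) → Fin (2 * m + 1)) x,
        Set.InjOn (update u j x) {i}ᶜ ↔
          Set.InjOn u {i, j}ᶜ ∧ ∀ k, k ≠ i → k ≠ j → u k ≠ x := by
      intro i j hij u x
      constructor
      · intro h
        refine ⟨fun k hk l hl hkl => ?_, fun k hki hkj hkx => hkj ?_⟩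
        · simp only [Set.mem_compl_iff, Set.mem_insert_iff, Set.mem_singleton_iff, not_or] at hk hl
          exact h hk.1 hl.1 (by simpa [hk.2, hl.2] using hkl)
        · exact h hki hij.symm (by simpa [hkj] using hkx)
      · rintro ⟨h1, h2⟩ k hk l hl hkl
        simp only [Set.mem_compl_iff, Set.mem_singleton_iff] at hk hl
        by_cases hkj : k = j <;> by_cases hlj : l = j
        · rw [hkj, hlj]
        · exact absurd (by simpa [hkj, hlj] using hkl.symm) (h2 l hl hlj)
        · exact absurd (by simpa [hkj, hlj] using hkl) (h2 k hk hkj)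
        · exact h1 (by simp [hk, hkj]) (by simp [hl, hlj]) (by simpa [hkj, hlj] using hkl)
    ext u
    simp only [marginal_apply]
    refine sum_congr rfl fun x _ => ?_
    have : Set.InjOn (update u j x) {i}ᶜ ↔ Set.InjOn (update u i x) {j}ᶜ := by
      rw [key i j hij, key j i hij.symm, Set.pair_comm]
      exact and_congr_right fun _ => forall_congr' fun k => ⟨fun h a b => h b a, fun h a b => h b a⟩
    simp only [this]

open Classical in
/-- The total of a weighting as in `exists_weight`. -/
theorem sum_eq_descFactorial {m N : ℕ} [NeZero N] {c : (Fin (m + 1) → Fin N) → ℤ}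
    (hc : ∀ i u, ∑ x, c (update u i x) = if Set.InjOn u {i}ᶜ then 1 else 0) :
    ∑ u, c u = N.descFactorial m := by
  rw [← (Fin.consEquiv fun _ : Fin (m + 1) => Fin N).sum_comp, Fintype.sum_prod_type_right]
  -- Summing out coordinate `0` leaves the number of injections `Fin m → Fin N`.
  have h : ∀ w : Fin m → Fin N, ∑ x, c (Fin.consEquiv (fun _ : Fin (m + 1) => Fin N) (x, w)) =
      if Injective w then 1 else 0 := by
    intro w
    have h := hc 0 (Fin.cons 0 w)
    simp only [Fin.update_cons_zero] at h
    have hw : Set.InjOn (Fin.cons 0 w : Fin (m + 1) → Fin N) {0}ᶜ ↔ Injective w := by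
      refine ⟨fun h a b hab => Fin.succ_injective _
        (h (Fin.succ_ne_zero a) (Fin.succ_ne_zero b) (by simpa using hab)), fun h a ha b hb => ?_⟩
      obtain ⟨a, rfl⟩ := Fin.exists_succ_eq.2 ha
      obtain ⟨b, rfl⟩ := Fin.exists_succ_eq.2 hb
      simpa using fun hab => h hab
    simp only [hw] at h
    exact h
  rw [sum_congr rfl fun w _ => h w, sum_boole, ← Fintype.card_subtype,
    Fintype.card_congr (Equiv.subtypeInjectiveEquivEmbedding _ _), Fintype.card_embedding_eq]
  simp

end SignedPlacement

/-! ### Signed sums over executions -/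

namespace AsyncLocal

open Finset Function

/-- Whether a node is still running. -/
def NodeState.isActive {St Out : Type*} : NodeState St Out → Bool
  | .active _ => true
  | .term _ => false

section Runs

variable {V Inp St Out : Type*} [Fintype V] [DecidableEq V]

/-- The running nodes of `S`. -/
def Config.running (c : Config V St Out) (S : Finset V) : Finset V :=
  S.filter fun v => (c.cur v).isActive

/-- The nonempty blocks of running nodes of `S`. -/
def Config.blocks (c : Config V St Out) (S : Finset V) : Finset (Finset V) :=
  (c.running S).powerset.erase ∅

/-- The signed sum of the final values of `g` over the executions that start in `c` and in which
exactly the running nodes of `S` are activated, until they have terminated. Executions longer than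
`k` are truncated. A block `B` contributes the sign `(-1) ^ (#B + 1)`. -/
def Algorithm.signedSum (A : Algorithm Inp St Out) (G : SimpleGraph V) [DecidableRel G.Adj]
    (S : Finset V) (g : (V → NodeState St Out) → ℤ) : ℕ → Config V St Out → ℤ
  | 0, c => g c.cur
  | k + 1, c =>
    if c.running S = ∅ then g c.cur
    else ∑ B ∈ c.blocks S, (-1) ^ (#B + 1) * A.signedSum G S g k (A.step G c B)

/-- All executions from `c` in which only running nodes of `S` are activated have at most `k`
nonempty steps. -/
def Algorithm.HaltsWithin (A : Algorithm Inp St Out) (G : SimpleGraph V) [DecidableRel G.Adj]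
    (S : Finset V) : ℕ → Config V St Out → Prop
  | 0, c => c.running S = ∅
  | k + 1, c => ∀ B ∈ c.blocks S, A.HaltsWithin G S k (A.step G c B)

variable {A : Algorithm Inp St Out} {G : SimpleGraph V} [DecidableRel G.Adj]
  {S : Finset V} {c c' : Config V St Out} {B : Finset V} {g : (V → NodeState St Out) → ℤ}

lemma Config.mem_running {v : V} : v ∈ c.running S ↔ v ∈ S ∧ (c.cur v).isActive := by
  simp [Config.running]

lemma Config.mem_blocks : B ∈ c.blocks S ↔ B.Nonempty ∧ B ⊆ c.running S := by
  simp [Config.blocks, nonempty_iff_ne_empty]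

lemma Config.running_mono {S' : Finset V} (h : S ⊆ S') : c.running S ⊆ c.running S' :=
  filter_subset_filter _ h

lemma Config.blocks_mono {S' : Finset V} (h : S ⊆ S') : c.blocks S ⊆ c.blocks S' :=
  erase_subset_erase _ (powerset_mono.2 (running_mono h))

lemma Config.blocks_eq_empty (h : c.running S = ∅) : c.blocks S = ∅ := by
  simp [Config.blocks, h]

lemma Algorithm.step_cur_of_notMem {v : V} (h : v ∉ B) : (A.step G c B).cur v = c.cur v := by
  simp [Algorithm.step, h]

lemma Algorithm.step_cur_congr {v : V} {B' : Finset V} (hv : v ∈ B ↔ v ∈ B')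
    (hcur : c.cur v = c'.cur v) (hw : c.write B = c'.write B') :
    (A.step G c B).cur v = (A.step G c' B').cur v := by
  simp only [step, hv, hcur, hw]

lemma Algorithm.haltsWithin_succ {k : ℕ} (h : A.HaltsWithin G S k c) :
    A.HaltsWithin G S (k + 1) c := by
  induction k generalizing c with
  | zero =>
    intro B hB
    rw [Config.blocks_eq_empty h] at hB
    simp at hB
  | succ k ih => exact fun B hB => ih (h B hB)

lemma Algorithm.haltsWithin_mono {k l : ℕ} (hkl : k ≤ l) (h : A.HaltsWithin G S k c) :
    A.HaltsWithin G S l c := by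
  induction hkl with
  | refl => exact h
  | step _ ih => exact haltsWithin_succ ih

lemma Algorithm.haltsWithin_of_subset {S' : Finset V} {k : ℕ} (hS : S' ⊆ S)
    (h : A.HaltsWithin G S k c) : A.HaltsWithin G S' k c := by
  induction k generalizing c with
  | zero => exact subset_empty.1 (h ▸ Config.running_mono hS)
  | succ k ih => exact fun B hB => ih (h B (Config.blocks_mono hS hB))

lemma Algorithm.signedSum_of_running_eq_empty (h : c.running S = ∅) (k : ℕ) :
    A.signedSum G S g k c = g c.cur := by
  cases k <;> simp [signedSum, h]

lemma Algorithm.signedSum_succ (h : c.running S ≠ ∅) (k : ℕ) :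
    A.signedSum G S g (k + 1) c =
      ∑ B ∈ c.blocks S, (-1) ^ (#B + 1) * A.signedSum G S g k (A.step G c B) := by
  simp [signedSum, h]

/-- Needed because `signedSum_erase` compares the single block `insert i B` with the two blocks
`{i}`, `B`, which use one more unit of the bound. -/
lemma Algorithm.signedSum_succ_eq {k : ℕ} (h : A.HaltsWithin G S k c) :
    A.signedSum G S g (k + 1) c = A.signedSum G S g k c := by
  induction k generalizing c with
  | zero => rw [signedSum_of_running_eq_empty h, signedSum_of_running_eq_empty h]
  | succ k ih =>
    by_cases hc : c.running S = ∅
    · rw [signedSum_of_running_eq_empty hc, signedSum_of_running_eq_empty hc]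
    · rw [signedSum_succ hc, signedSum_succ hc]
      exact sum_congr rfl fun B hB => by rw [ih (h B hB)]

/-- The registers, and the states of the nodes in `S`, determine the signed sum over `S`. -/
lemma Algorithm.signedSum_congr (hg : ∀ f f', (∀ v ∈ S, f v = f' v) → g f = g f') (k : ℕ)
    (hreg : c.reg = c'.reg) (hcur : ∀ v ∈ S, c.cur v = c'.cur v) :
    A.signedSum G S g k c = A.signedSum G S g k c' := by
  induction k generalizing c c' with
  | zero => exact hg _ _ hcur
  | succ k ih =>
    have hrun : c.running S = c'.running S := filter_congr fun v hv => by rw [hcur v hv]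
    have hbl : c.blocks S = c'.blocks S := by rw [Config.blocks, hrun, Config.blocks]
    simp only [signedSum, hrun, hbl, hg _ _ hcur]
    split_ifs
    · rfl
    · refine sum_congr rfl fun B hB => ?_
      have hBS : B ⊆ S := (Config.mem_blocks.1 hB).2.trans (filter_subset _ _)
      have hw : c.write B = c'.write B := by
        ext1 v
        simp only [Config.write, hreg]
        split_ifs with hv
        · rw [hcur v (hBS hv)]
        · rfl
      rw [ih (c := A.step G c B) (c' := A.step G c' B) hw fun v hv => ?_]
      exact step_cur_congr Iff.rfl (hcur v hv) hw

/-- Activating `i` alone and then a block `B` looks, except to `i`, like activating them together. -/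
lemma Algorithm.signedSum_step_insert {i : V} (hi : i ∉ S) (hB : B ⊆ S)
    (hg : ∀ f f', (∀ v ∈ S, f v = f' v) → g f = g f') (k : ℕ) :
    A.signedSum G S g k (A.step G (A.step G c {i}) B) =
      A.signedSum G S g k (A.step G c (insert i B)) := by
  have hiB : i ∉ B := fun h => hi (hB h)
  have hw : (A.step G c {i}).write B = c.write (insert i B) := by
    ext1 v
    simp only [Config.write, step]
    by_cases hvi : v = i
    · subst hvi
      simp [hiB]
    · simp [hvi]
  refine signedSum_congr hg k hw fun v hv => ?_
  have hvi : v ≠ i := ne_of_mem_of_not_mem hv hi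
  have hcur : (A.step G c {i}).cur v = c.cur v := step_cur_of_notMem (by simpa using hvi)
  exact step_cur_congr (by simp [hvi]) hcur hw

/-- A node on whose state the values of `g` do not depend may be left out. -/
theorem Algorithm.signedSum_erase {i : V} {k : ℕ} (h : A.HaltsWithin G S k c)
    (hg : ∀ f f', (∀ v ∈ S.erase i, f v = f' v) → g f = g f') :
    A.signedSum G S g k c = A.signedSum G (S.erase i) g k c := by
  induction k generalizing c with
  | zero => rfl
  | succ k ih =>
    by_cases hc : c.running S = ∅
    · rw [signedSum_of_running_eq_empty hc, signedSum_of_running_eq_empty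
        (subset_empty.1 (hc ▸ Config.running_mono (erase_subset _ _)))]
    have hrun : c.running (S.erase i) = (c.running S).erase i := by
      simp [Config.running, filter_erase]
    rw [signedSum_succ hc, sum_congr rfl fun B hB => by rw [ih (h B hB)]]
    by_cases hia : i ∈ c.running S
    swap
    · rw [erase_eq_of_notMem hia] at hrun
      rw [signedSum_succ (hrun ▸ hc), Config.blocks, Config.blocks, hrun]
    set T := (c.running S).erase i with hT
    have hiT : i ∉ T := notMem_erase _ _
    have hTS : T ⊆ S.erase i := erase_subset_erase _ (filter_subset _ _)
    have hst : A.HaltsWithin G (S.erase i) k (A.step G c {i}) :=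
      haltsWithin_of_subset (erase_subset _ _) (h _ (Config.mem_blocks.2 (by simpa using hia)))
    have hsr : (A.step G c {i}).running (S.erase i) = T := by
      rw [← hrun]
      exact filter_congr fun v hv => by
        rw [step_cur_of_notMem (by simpa using ne_of_mem_erase hv)]
    have hsplit : ∀ f : Finset V → ℤ, ∑ B ∈ c.blocks S, f B =
        ∑ B ∈ T.powerset.erase ∅, f B + (f {i} + ∑ B ∈ T.powerset.erase ∅, f (insert i B)) := by
      intro f
      have h1 : c.running S = insert i T := (insert_erase hia).symm
      have h2 : ∀ φ : Finset V → ℤ, ∑ B ∈ T.powerset, φ B = φ ∅ + ∑ B ∈ T.powerset.erase ∅, φ B :=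
        fun φ => (add_sum_erase _ _ (empty_mem_powerset T)).symm
      have h3 := add_sum_erase (c.running S).powerset f (empty_mem_powerset _)
      have h4 := sum_powerset_insert hiT f
      rw [← h1, ← h3, h2, h2 fun B => f (insert i B)] at h4
      simp only [insert_empty_eq] at h4
      rw [Config.blocks]
      linarith
    rw [hsplit]
    -- If only `i` is running, nothing follows `{i}` and no cancellation occurs: the term of `{i}`
    -- is the whole sum.
    by_cases hTe : T = ∅
    · rw [signedSum_of_running_eq_empty (S := S.erase i) (c := c) (by rw [hrun, hTe])]
      simp only [hTe, powerset_empty, erase_singleton, sum_empty]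
      rw [signedSum_of_running_eq_empty (by rw [hsr, hTe])]
      simp only [card_singleton, zero_add, add_zero]
      rw [hg (A.step G c {i}).cur c.cur fun v hv =>
        step_cur_of_notMem (by simpa using ne_of_mem_erase hv)]
      norm_num
    -- Expanding the term of `{i}` by the next block `B` gives the terms of the blocks `insert i B`
    -- with opposite signs.
    · have hzero : (-1) ^ (#{i} + 1) * A.signedSum G (S.erase i) g k (A.step G c {i}) +
          ∑ B ∈ T.powerset.erase ∅, (-1) ^ (#(insert i B) + 1) *
            A.signedSum G (S.erase i) g k (A.step G c (insert i B)) = 0 := by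
        rw [← signedSum_succ_eq hst, signedSum_succ (by rwa [hsr]), Config.blocks, hsr,
          card_singleton, mul_sum, ← sum_add_distrib]
        refine sum_eq_zero fun B hB => ?_
        have hBT : B ⊆ T := mem_powerset.1 (mem_of_mem_erase hB)
        rw [signedSum_step_insert (notMem_erase _ _) (hBT.trans hTS) hg,
          card_insert_of_notMem fun hiB => hiT (hBT hiB)]
        ring
      rw [hzero, add_zero, signedSum_succ (by rwa [hrun]), Config.blocks, hrun]

/-- Leaving out the nodes outside `U` one by one reduces to executions in which these nodes never
take a step. -/
theorem Algorithm.signedSum_of_subset {U : Finset V} (hU : U ⊆ S) {k : ℕ}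
    (h : A.HaltsWithin G S k c) (hg : ∀ f f', (∀ v ∈ U, f v = f' v) → g f = g f') :
    A.signedSum G S g k c = A.signedSum G U g k c := by
  induction hn : #(S \ U) generalizing S with
  | zero =>
    rw [card_eq_zero, sdiff_eq_empty_iff_subset] at hn
    rw [Subset.antisymm hU hn]
  | succ n ih =>
    obtain ⟨i, hi⟩ : (S \ U).Nonempty := card_pos.1 (by omega)
    obtain ⟨hiS, hiU⟩ := mem_sdiff.1 hi
    have hUe : U ⊆ S.erase i := subset_erase.2 ⟨hU, hiU⟩
    rw [signedSum_erase h fun f f' hf => hg f f' fun v hv => hf v (hUe hv)]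
    refine ih hUe (haltsWithin_of_subset (erase_subset _ _) h) ?_
    rw [erase_sdiff_comm, card_erase_of_mem hi, hn, Nat.add_sub_cancel]

lemma Algorithm.signedSum_sum {ι : Type*} (s : Finset ι) (a : ι → ℤ)
    (f : ι → (V → NodeState St Out) → ℤ) (k : ℕ) :
    A.signedSum G S (fun x => ∑ j ∈ s, a j * f j x) k c =
      ∑ j ∈ s, a j * A.signedSum G S (f j) k c := by
  induction k generalizing c with
  | zero => rfl
  | succ k ih =>
    by_cases hc : c.running S = ∅
    · simp only [signedSum_of_running_eq_empty hc]
    · simp only [signedSum_succ hc, ih, mul_sum]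
      rw [sum_comm]
      exact sum_congr rfl fun j _ => sum_congr rfl fun B _ => by ring

/-- The pullback of a configuration along a permutation of the nodes. -/
def Config.pullback (c : Config V St Out) (σ : Equiv.Perm V) : Config V St Out where
  reg := c.reg ∘ σ
  cur := c.cur ∘ σ

/-- A node reads its neighbors' registers as a multiset, which automorphisms of `G` respect. -/
lemma Algorithm.step_pullback {σ : Equiv.Perm V} (hσ : ∀ u v, G.Adj (σ u) (σ v) ↔ G.Adj u v)
    (c : Config V St Out) (B : Finset V) :
    A.step G (c.pullback σ) B = (A.step G c (B.map σ.toEmbedding)).pullback σ := by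
  have hw : (c.pullback σ).write B = c.write (B.map σ.toEmbedding) ∘ σ := by
    ext1 v
    simp [Config.write, Config.pullback]
  have hn : ∀ v, G.neighborFinset (σ v) = (G.neighborFinset v).map σ.toEmbedding := by
    intro v
    ext w
    obtain ⟨w, rfl⟩ := σ.surjective w
    simp [hσ]
  simp only [step, Config.pullback, Config.mk.injEq]
  refine ⟨hw, ?_⟩
  ext1 v
  have hw' := hw
  simp only [Config.pullback] at hw'
  simp only [comp_apply, mem_map_equiv, Equiv.symm_apply_apply, hn, map_val, Multiset.map_map,
    Equiv.coe_toEmbedding, hw']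

lemma Algorithm.signedSum_pullback {σ : Equiv.Perm V} (hσ : ∀ u v, G.Adj (σ u) (σ v) ↔ G.Adj u v)
    (S : Finset V) (g : (V → NodeState St Out) → ℤ) (k : ℕ) (c : Config V St Out) :
    A.signedSum G S (fun f => g (f ∘ σ.symm)) k (c.pullback σ) =
      A.signedSum G (S.map σ.toEmbedding) g k c := by
  have hrun : ∀ c : Config V St Out,
      c.running (S.map σ.toEmbedding) = ((c.pullback σ).running S).map σ.toEmbedding := by
    intro c
    ext w
    obtain ⟨w, rfl⟩ := σ.surjective w
    simp [Config.mem_running, Config.pullback]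
  have hg : ∀ c : Config V St Out, g ((c.pullback σ).cur ∘ σ.symm) = g c.cur := fun c => by
    congr 1
    ext1 v
    simp [Config.pullback]
  induction k generalizing c with
  | zero => exact hg c
  | succ k ih =>
    by_cases hc : (c.pullback σ).running S = ∅
    · rw [signedSum_of_running_eq_empty hc, signedSum_of_running_eq_empty (by rw [hrun, hc, map_empty]),
        hg]
    · rw [signedSum_succ hc, signedSum_succ (by rwa [hrun, Ne, map_eq_empty])]
      refine sum_bij (fun B _ => B.map σ.toEmbedding) (fun B hB => ?_)
        (fun B _ B' _ h => map_injective _ h) (fun B hB => ?_) fun B hB => ?_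
      · rw [Config.mem_blocks] at hB ⊢
        rw [hrun]
        exact ⟨hB.1.map, map_subset_map.2 hB.2⟩
      · rw [Config.mem_blocks, hrun, subset_map_iff] at hB
        obtain ⟨hne, B', hB', rfl⟩ := hB
        exact ⟨B', Config.mem_blocks.2 ⟨map_nonempty.1 hne, hB'⟩, rfl⟩
      · rw [step_pullback hσ, ih, card_map]

end Runs

/-! ### Reachable configurations and wait-freeness -/

section Executions

variable {V Inp St Out : Type*} [Fintype V] [DecidableEq V] {A : Algorithm Inp St Out}
  {G : SimpleGraph V} [DecidableRel G.Adj] {ident : V → ℕ} {inp : V → Inp}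

lemma Algorithm.run_congr {S S' : ℕ → Finset V} {t : ℕ} (h : ∀ s < t, S s = S' s) :
    A.run G ident inp S t = A.run G ident inp S' t := by
  induction t with
  | zero => rfl
  | succ t ih => rw [run, run, ih fun s hs => h s (by omega), h t (by omega)]

/-- If `g` vanishes in all reachable terminal configurations, then so does its signed sum. -/
theorem Algorithm.signedSum_eq_zero {g : (V → NodeState St Out) → ℤ}
    (hg : ∀ S t, (A.run G ident inp S t).running univ = ∅ → g (A.run G ident inp S t).cur = 0)
    {k : ℕ} (S : ℕ → Finset V) (t : ℕ) (h : A.HaltsWithin G univ k (A.run G ident inp S t)) :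
    A.signedSum G univ g k (A.run G ident inp S t) = 0 := by
  induction k generalizing S t with
  | zero => exact hg S t h
  | succ k ih =>
    by_cases hc : (A.run G ident inp S t).running univ = ∅
    · rw [signedSum_of_running_eq_empty hc, hg S t hc]
    · rw [signedSum_succ hc]
      refine sum_eq_zero fun B hB => ?_
      have hrun : A.run G ident inp (update S t B) (t + 1) =
          A.step G (A.run G ident inp S t) B := by
        rw [run, update_self, run_congr fun s hs => update_of_ne hs.ne _ _]
      rw [← hrun, ih _ _ (by rw [hrun]; exact h B hB), mul_zero]

lemma Algorithm.run_cur_term {S : ℕ → Finset V} {v : V} {x : Out} {t s : ℕ} (hts : t ≤ s)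
    (h : (A.run G ident inp S t).cur v = .term x) : (A.run G ident inp S s).cur v = .term x := by
  induction hts with
  | refl => exact h
  | step _ ih => simp only [run, step, ih, ite_self]

/-- Wait-freeness bounds the lengths of the executions. -/
theorem Algorithm.exists_haltsWithin
    (h : ∀ S : ℕ → Finset V, ∀ v, (∀ t₀, ∃ t, t₀ ≤ t ∧ v ∈ S t) →
      ∃ t x, (A.run G ident inp S t).cur v = .term x) :
    ∃ k, A.HaltsWithin G univ k (A.run G ident inp (fun _ => ∅) 0) := by
  by_contra hcon
  -- König's argument: there are finitely many blocks, so a configuration without a bound has a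
  -- successor without a bound.
  have hex : ∀ c : Config V St Out, ∃ B, (¬ ∃ k, A.HaltsWithin G univ k c) →
      B ∈ c.blocks univ ∧ ¬ ∃ k, A.HaltsWithin G univ k (A.step G c B) := by
    intro c
    by_contra! hc
    have hB : ∀ B ∈ c.blocks univ, ∃ k, A.HaltsWithin G univ k (A.step G c B) := fun B hB =>
      (hc B).2 hB
    choose! k hk using hB
    refine absurd ?_ (not_exists.2 (hc ∅).1)
    exact ⟨(c.blocks univ).sup k + 1, fun B hB => haltsWithin_mono (le_sup hB) (hk B hB)⟩
  choose pick hpick using hex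
  let conf : ℕ → Config V St Out := fun t =>
    Nat.rec (A.run G ident inp (fun _ => ∅) 0) (fun _ c => A.step G c (pick c)) t
  let S : ℕ → Finset V := fun t => pick (conf t)
  have hrun : ∀ t, A.run G ident inp S t = conf t := by
    intro t
    induction t with
    | zero => rfl
    | succ t ih => rw [run, ih]
  have hbad : ∀ t, ¬ ∃ k, A.HaltsWithin G univ k (conf t) := by
    intro t
    induction t with
    | zero => exact hcon
    | succ t ih => exact (hpick _ ih).2
  have hblock : ∀ t, S t ∈ (conf t).blocks univ := fun t => (hpick _ (hbad t)).1
  -- Otherwise the nonempty block at a time past the last activation of every node would contain no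
  -- node.
  obtain ⟨v, hv⟩ : ∃ v, ∀ t₀, ∃ t, t₀ ≤ t ∧ v ∈ S t := by
    by_contra! hno
    choose b hb using hno
    obtain ⟨v, hv⟩ := (Config.mem_blocks.1 (hblock (univ.sup b))).1
    exact hb v _ (le_sup (mem_univ v)) hv
  obtain ⟨t, x, htx⟩ := h S v hv
  obtain ⟨s, hts, hvs⟩ := hv t
  have hact := (Config.mem_running.1 ((Config.mem_blocks.1 (hblock s)).2 hvs)).2
  rw [← hrun, run_cur_term hts htx] at hact
  simp [NodeState.isActive] at hact

end Executions

end AsyncLocal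

/-! ### Divisibility and averaging -/

open Finset Function

/-- A sum over the `k`-subsets of `Fin n` that is invariant under rotation is divisible by `n`, if
`n` is prime and `0 < k < n`. -/
lemma prime_dvd_sum_of_rotation_invariant {m k : ℕ} (hm : (m + 1).Prime) (hk : k ≠ 0)
    (hkm : k < m + 1) {Φ : Finset (Fin (m + 1)) → ℤ}
    (hΦ : ∀ U, #U = k → Φ (U.map (Equiv.addRight 1).toEmbedding) = Φ U) :
    ((m + 1 : ℕ) : ℤ) ∣ ∑ U with #U = k, Φ U := by
  -- Double counting of pairs `j ∈ U`: `T` is constant by rotation, so `k` times the sum is `(m + 1)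
  -- * T 0`.
  let T : Fin (m + 1) → ℤ := fun j => ∑ U with #U = k, if j ∈ U then Φ U else 0
  have hsucc : ∀ j, T (j + 1) = T j := by
    intro j
    simp only [T, sum_filter]
    rw [← ((Equiv.addRight (1 : Fin (m + 1))).finsetCongr).sum_comp]
    refine sum_congr rfl fun U _ => ?_
    rw [Equiv.finsetCongr_apply, card_map]
    by_cases hU : #U = k
    · rw [if_pos hU, if_pos hU, hΦ U hU]
      exact if_congr (by simp) rfl rfl
    · rw [if_neg hU, if_neg hU]
  have hT : ∀ j, T j = T 0 := by
    intro j
    induction j using Fin.induction with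
    | zero => rfl
    | succ j ih => rw [← Fin.coeSucc_eq_succ, hsucc, ih]
  have hmul : (k : ℤ) * ∑ U with #U = k, Φ U = ((m + 1 : ℕ) : ℤ) * T 0 := by
    have h1 : ∑ j, T j = ((m + 1 : ℕ) : ℤ) * T 0 := by simp [hT]
    rw [← h1, sum_comm, mul_sum]
    refine sum_congr rfl fun U hU => ?_
    rw [← sum_filter, sum_const, filter_mem_eq_inter, univ_inter, (mem_filter.1 hU).2, nsmul_eq_mul]
  refine ((Nat.prime_iff_prime_int.1 hm).dvd_or_dvd ⟨_, hmul⟩).resolve_left fun h => ?_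
  exact absurd (Nat.le_of_dvd (Nat.pos_of_ne_zero hk) (Int.natCast_dvd_natCast.1 h)) (by omega)

/-- The factors `m + 2, …, 2 * m + 1` lie strictly between `m + 1` and `2 * (m + 1)`. -/
lemma not_prime_dvd_descFactorial {m : ℕ} (hm : (m + 1).Prime) :
    ¬ m + 1 ∣ (2 * m + 1).descFactorial m := by
  rw [Nat.descFactorial_eq_prod_range, hm.prime.dvd_finsetProd_iff]
  rintro ⟨i, hi, q, hq⟩
  rw [mem_range] at hi
  have h1 : q < 2 := by
    by_contra! h
    have := Nat.mul_le_mul_left (m + 1) h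
    omega
  have := Nat.mul_le_mul_left (m + 1) (Nat.le_of_lt_succ h1)
  omega

lemma sum_sum_update {V I : Type*} [Fintype V] [DecidableEq V] [Fintype I] (i : V)
    (F : (V → I) → ℤ) :
    ∑ u, ∑ x, F (update u i x) = Fintype.card I * ∑ u, F u := by
  have hinv : Involutive fun p : (V → I) × I => (update p.1 i p.2, p.1 i) := fun p => by simp
  rw [← Fintype.sum_prod_type' (f := fun u x => F (update u i x)),
    ← Equiv.sum_comp (hinv.toPerm _), Fintype.sum_prod_type]
  simp [mul_sum]

/-- Averaging over the value at `i` pulls `h` out of the sum of `d`. -/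
lemma sum_mul_eq_zero {V I : Type*} [Fintype V] [DecidableEq V] [Fintype I] [Nonempty I] {i : V}
    {d h : (V → I) → ℤ} (hd : ∀ u, ∑ x, d (update u i x) = 0)
    (hh : ∀ u x, h (update u i x) = h u) : ∑ u, d u * h u = 0 := by
  have key := sum_sum_update i fun u => d u * h u
  simp only [hh, ← sum_mul, hd, zero_mul, sum_const_zero] at key
  exact (mul_eq_zero.1 key.symm).resolve_left (by simp)

/-! ### Outputs, and the contradiction -/

namespace AsyncLocal

/-- The output of a node as an integer, with `0` for running nodes. -/
def NodeState.output {St : Type*} : NodeState St (Fin 2) → ℤ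
  | .active _ => 0
  | .term x => (x : ℕ)

/-- The indicator that all nodes of `U` have output `1`. -/
def allOne {V St : Type*} (U : Finset V) (f : V → NodeState St (Fin 2)) : ℤ :=
  ∏ v ∈ U, (f v).output

lemma allOne_congr {V St : Type*} {U : Finset V} (f f' : V → NodeState St (Fin 2))
    (h : ∀ v ∈ U, f v = f' v) : allOne U f = allOne U f' :=
  prod_congr rfl fun v hv => by rw [h v hv]

/-- Both colors occur, so the product of the `1 - x v`, which expands to the sum over all `U`,
vanishes, and so does its term for `univ`. -/
lemma sum_allOne_eq_zero {V St : Type*} [Fintype V] [DecidableEq V] {f : V → NodeState St (Fin 2)}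
    {x : V → Fin 2} (hx : ∀ v, f v = .term (x v)) {u v : V} (huv : x u ≠ x v) :
    ∑ U ∈ univ.erase univ, (-1) ^ #U * allOne U f = 0 := by
  have hout : ∀ v, (f v).output = ((x v : ℕ) : ℤ) := fun v => by rw [hx v]; rfl
  have hval : ∀ y : Fin 2, ∃ w, x w = y := by
    intro y
    by_cases h : x u = y
    · exact ⟨u, h⟩
    · exact ⟨v, by omega⟩
  obtain ⟨a, ha⟩ := hval 0
  obtain ⟨b, hb⟩ := hval 1
  have h0 : allOne univ f = 0 := prod_eq_zero (mem_univ a) (by simp [hout, ha])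
  have h1 : ∏ w, (-(f w).output + 1) = 0 := prod_eq_zero (mem_univ b) (by simp [hout, hb])
  rw [prod_add_one, powerset_univ] at h1
  have h2 : ∑ U, (-1) ^ #U * allOne U f = 0 := by
    rw [← h1]
    exact sum_congr rfl fun U _ => by rw [allOne, ← prod_neg]
  rw [← add_sum_erase _ _ (mem_univ univ), h0, mul_zero, zero_add] at h2
  exact h2

end AsyncLocal

open AsyncLocal in
theorem corollary6 (n : ℕ) (hn : n.Prime) (hn3 : 3 ≤ n) (N : ℕ) (hN : 2 * n - 1 ≤ N)
    {Inp St : Type*} (common : Inp) :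
    ¬ ∃ A : AsyncLocal.Algorithm Inp St (Fin 2),
      A.Solves (SimpleGraph.cycleGraph n) N (fun _ => common)
        (AsyncLocal.IsWeakTwoColoring (SimpleGraph.cycleGraph n)) := by
  rintro ⟨A, hA⟩
  obtain ⟨m, rfl⟩ : ∃ m, n = m + 1 := ⟨n - 1, by omega⟩
  set G := SimpleGraph.cycleGraph (m + 1) with hG
  obtain ⟨c, hcinj, hc⟩ := SignedPlacement.exists_weight m
  let ident : (Fin (m + 1) → Fin (2 * m + 1)) → Fin (m + 1) → ℕ := fun u v => u v + 1
  let start : (Fin (m + 1) → Fin (2 * m + 1)) → Config (Fin (m + 1)) St (Fin 2) := fun u =>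
    A.run G (ident u) (fun _ => common) (fun _ => ∅) 0
  have hsolves : ∀ u, Injective u → _ := fun u hu => hA (ident u)
    (fun v w h => hu (Fin.ext (by simpa [ident] using h)))
    (fun v => ⟨by simp [ident], by have := (u v).2; simp only [ident]; omega⟩)
  have hbound : ∀ u, ∃ k, Injective u → A.HaltsWithin G univ k (start u) := by
    intro u
    by_cases hu : Injective u
    · obtain ⟨k, hk⟩ := Algorithm.exists_haltsWithin fun S => (hsolves u hu S).1
      exact ⟨k, fun _ => hk⟩
    · exact ⟨0, fun h => absurd h hu⟩
  choose b hb using hbound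
  -- One bound for all injective `u` makes `H U` a single function, defined for all `u`. It stays
  -- local even where truncation may occur, and `c` vanishes at the non-injective `u`.
  let K := univ.sup b
  have hK : ∀ u, Injective u → A.HaltsWithin G univ K (start u) := fun u hu =>
    Algorithm.haltsWithin_mono (le_sup (mem_univ u)) (hb u hu)
  let H : Finset (Fin (m + 1)) → (Fin (m + 1) → Fin (2 * m + 1)) → ℤ := fun U u =>
    A.signedSum G U (allOne U) K (start u)
  have hadj : G.Adj 0 1 := by
    rw [hG, SimpleGraph.cycleGraph_adj']
    right
    rw [sub_zero, Fin.val_one']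
    exact Nat.mod_eq_of_lt (by omega)
  have hsum : ∀ u, Injective u → ∑ U ∈ univ.erase univ, (-1) ^ #U * H U u = 0 := by
    intro u hu
    rw [← Algorithm.signedSum_eq_zero (A := A) (G := G) (ident := ident u)
      (inp := fun _ => common) (g := fun f => ∑ U ∈ univ.erase univ, (-1) ^ #U * allOne U f)
      ?_ (fun _ => ∅) 0 (hK u hu), Algorithm.signedSum_sum]
    · exact sum_congr rfl fun U _ => congrArg _
        (Algorithm.signedSum_of_subset (subset_univ U) (hK u hu) allOne_congr).symm
    · intro S t ht
      have hterm : ∀ v, ∃ x, (A.run G (ident u) (fun _ => common) S t).cur v = .term x := by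
        intro v
        have hv : v ∉ (A.run G (ident u) (fun _ => common) S t).running univ := by simp [ht]
        rw [Config.mem_running] at hv
        cases h : (A.run G (ident u) (fun _ => common) S t).cur v with
        | active s => simp [h, NodeState.isActive] at hv
        | term x => exact ⟨x, rfl⟩
      choose x hx using hterm
      -- All that is used of a weak 2-coloring is that it is not constant.
      obtain ⟨w, -, hw⟩ := (hsolves u hu S).2 t x hx 0 ⟨1, hadj⟩
      exact sum_allOne_eq_zero hx hw
  have hlocal : ∀ U i, i ∉ U → ∀ u x, H U (update u i x) = H U u := by
    intro U i hi u x
    refine Algorithm.signedSum_congr allOne_congr K rfl fun v hv => ?_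
    simp only [start, Algorithm.run, ident, update_of_ne (ne_of_mem_of_not_mem hv hi)]
  let σ : Equiv.Perm (Fin (m + 1)) := Equiv.addRight 1
  have hσ : ∀ u v, G.Adj (σ u) (σ v) ↔ G.Adj u v := by
    intro u v
    simp [hG, SimpleGraph.cycleGraph_adj', σ]
  have hrot : ∀ U u, H (U.map σ.toEmbedding) u = H U (u ∘ σ) := by
    intro U u
    have h : (fun f : Fin (m + 1) → NodeState St (Fin 2) =>
        allOne (U.map σ.toEmbedding) (f ∘ σ.symm)) = allOne U := by
      ext f
      simp [allOne]
    simp only [H]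
    rw [← Algorithm.signedSum_pullback hσ, h]
    rfl
  let Q : Finset (Fin (m + 1)) → ℤ := fun U => ∑ u, c u * H U u
  have hQrot : ∀ U, U ≠ univ → Q (U.map σ.toEmbedding) = Q U := by
    intro U hU
    obtain ⟨i, hi⟩ : ∃ i, i ∉ U := by
      by_contra! h
      exact hU (eq_univ_iff_forall.2 h)
    have h1 : Q (U.map σ.toEmbedding) = ∑ u, c (u ∘ σ.symm) * H U u := by
      rw [← (Equiv.arrowCongr σ.symm (Equiv.refl (Fin (2 * m + 1)))).sum_comp]
      refine sum_congr rfl fun u _ => ?_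
      rw [hrot]
      congr 2
      ext1 v
      simp
    rw [h1, ← sub_eq_zero, ← sum_sub_distrib]
    simp only [← sub_mul]
    -- The rotated weighting has the same marginals as `c`, and `H U` ignores the coordinate `i`.
    refine sum_mul_eq_zero (i := i) (fun u => ?_) (hlocal U i hi)
    have hinj : Set.InjOn (u ∘ σ.symm) {σ i}ᶜ ↔ Set.InjOn u {i}ᶜ := by
      constructor
      · intro h a ha b hb hab
        exact σ.injective (h (by simpa using ha) (by simpa using hb) (by simpa using hab))
      · intro h a ha b hb hab
        refine σ.symm.injective (h ?_ ?_ hab)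
        · simpa [Equiv.symm_apply_eq] using ha
        · simpa [Equiv.symm_apply_eq] using hb
    simp only [sum_sub_distrib, update_comp_equiv, Equiv.symm_symm, hc]
    classical exact sub_eq_zero.2 (if_congr hinj rfl rfl)
  have hQ0 : Q ∅ = ((2 * m + 1).descFactorial m : ℕ) := by
    rw [← SignedPlacement.sum_eq_descFactorial hc]
    refine sum_congr rfl fun u _ => ?_
    simp only [H]
    rw [Algorithm.signedSum_of_running_eq_empty (by simp [Config.running])]
    simp [allOne]
  have htotal : ∑ U ∈ univ.erase univ, (-1) ^ #U * Q U = 0 := by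
    simp only [Q, mul_sum]
    rw [sum_comm]
    refine sum_eq_zero fun u _ => ?_
    simp only [mul_left_comm _ (c u), ← mul_sum]
    by_cases hu : c u = 0
    · rw [hu, zero_mul]
    · rw [hsum u (hcinj u hu), mul_zero]
  have hproper : ∀ k ∈ Ico 1 (m + 1), ((m + 1 : ℕ) : ℤ) ∣ ∑ U with #U = k, (-1) ^ #U * Q U := by
    intro k hk
    rw [mem_Ico] at hk
    refine prime_dvd_sum_of_rotation_invariant hn (by omega) hk.2 fun U hU => ?_
    rw [card_map, hQrot U]
    rintro rfl
    simp at hU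
    omega
  have hempty : (∅ : Finset (Fin (m + 1))) ∈ univ.erase univ :=
    mem_erase.2 ⟨univ_nonempty.ne_empty.symm, mem_univ _⟩
  have hcard : ∀ U : Finset (Fin (m + 1)), U ∈ (univ.erase univ).erase ∅ ↔ #U ∈ Ico 1 (m + 1) := by
    intro U
    have h1 := card_le_univ U
    have h2 := card_eq_iff_eq_univ U
    rw [Fintype.card_fin] at h1 h2
    simp only [mem_erase, mem_univ, and_true, mem_Ico, Nat.one_le_iff_ne_zero, Ne, card_eq_zero,
      ← h2]
    exact and_congr_right fun _ => ⟨fun h => lt_of_le_of_ne h1 h, fun h => h.ne⟩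
  have hdvd : ((m + 1 : ℕ) : ℤ) ∣ ∑ U ∈ (univ.erase univ).erase ∅, (-1) ^ #U * Q U := by
    rw [← sum_fiberwise_of_maps_to (t := Ico 1 (m + 1)) (g := card) fun U hU => (hcard U).1 hU]
    refine dvd_sum fun k hk => ?_
    refine (hproper k hk).trans (dvd_of_eq (sum_congr ?_ fun _ _ => rfl))
    ext U
    simp only [mem_filter, hcard, mem_univ, true_and, iff_and_self]
    rintro rfl
    exact hk
  rw [← add_sum_erase _ _ hempty, card_empty, pow_zero, one_mul, hQ0] at htotal
  refine not_prime_dvd_descFactorial hn (Int.natCast_dvd_natCast.1 ?_)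
  rw [eq_neg_of_add_eq_zero_left htotal]
  exact (dvd_neg).2 hdvd
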